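/- Let $K$ be a field, $K^*$ its group of units, and $n\ge 0$ an integer. Let $\mathbb{S}_n$ be the algebra of one-sided inverses of $K[x_1,\dots,x_n]$, i.e. the associative unital $K$-algebra generated by $2n$ elements $x_1,\dots,x_n,y_1,\dots,y_n$ subject to the defining relations $$y_1x_1=\cdots=y_nx_n=1,\qquad [x_i,y_j]=[x_i,x_j]=[y_i,y_j]=0\quad\text{for all } i\ne j,$$ where $[a,b]=ab-ba$ (so $\mathbb{S}_0=K$). A two-sided ideal $\mathfrak{p}$ of $\mathbb{S}_n$ is prime if $\mathfrak{p}\neq\mathbb{S}_n$ and, for two-sided ideals $I,J$, $IJ\subseteq\mathfrak{p}$ implies $I\subseteq\mathfrak{p}$ or $J\subseteq\mathfrak{p}$; its height is the supremum of the lengths $m$ of chains $\mathfrak{p}_0\subsetneq\cdots\subsetneq\mathfrak{p}_m=\mathfrak{p}$ of prime ideals. Let $\mathfrak{a}_n$ be the sum of all prime ideals of height $1$ of $\mathbb{S}_n$. Let $\mathbb{S}_n^*$ be the group of units of $\mathbb{S}_n$ and $(1+\mathfrak{a}_n)^*$ the group of units of the multiplicative monoid $1+\mathfrak{a}_n=\{1+a: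 a\in\mathfrak{a}_n\}$. For $u\in\mathbb{S}_n^*$ let $\omega_u$ be the inner automorphism $a\mapsto uau^{-1}$ of $\mathbb{S}_n$, and let $\mathrm{Inn}(\mathbb{S}_n)=\{\omega_u: u\in\mathbb{S}_n^*\}$. Then: 1. $\mathbb{S}_n^*=K^*\times(1+\mathfrak{a}_n)^*$, i.e. the map $K^*\times(1+\mathfrak{a}_n)^*\to\mathbb{S}_n^*$, $(\lambda,u)\mapsto\lambda u$, is a group isomorphism. 2. The centre of the group $\mathbb{S}_n^*$ is $K^*$ (the group of nonzero scalars), and the centre of the group $(1+\mathfrak{a}_n)^*$ is $\{1\}$. 3. The map $(1+\mathfrak{a}_n)^*\to\mathrm{Inn}(\mathbb{S}_n)$, $u\mapsto\omega_u$, is a group isomorphism. -/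

import Mathlib

/-- The `2n` generators `x i`, `y i` of the algebra of one-sided inverses. -/
inductive OneSidedInvGen (n : ℕ) : Type
  | x (i : Fin n) : OneSidedInvGen n
  | y (i : Fin n) : OneSidedInvGen n

open OneSidedInvGen FreeAlgebra in
/-- The defining relations of the algebra of one-sided inverses:
`y i * x i = 1` for all `i`, and for `i ≠ j` each of `x i, y i` commutes with each of `x j, y j`. -/
inductive OneSidedInvRel (K : Type*) [Field K] (n : ℕ) :
    FreeAlgebra K (OneSidedInvGen n) → FreeAlgebra K (OneSidedInvGen n) → Prop
  | y_mul_x (i : Fin n) : OneSidedInvRel K n (ι K (y i) * ι K (x i)) 1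
  | x_comm_y (i j : Fin n) (hij : i ≠ j) :
      OneSidedInvRel K n (ι K (x i) * ι K (y j)) (ι K (y j) * ι K (x i))
  | x_comm_x (i j : Fin n) (hij : i ≠ j) :
      OneSidedInvRel K n (ι K (x i) * ι K (x j)) (ι K (x j) * ι K (x i))
  | y_comm_y (i j : Fin n) (hij : i ≠ j) :
      OneSidedInvRel K n (ι K (y i) * ι K (y j)) (ι K (y j) * ι K (y i))

/-- The algebra `𝕊ₙ` of one-sided inverses of the polynomial algebra `K[x₁, …, xₙ]`,
given by generators and relations. -/
abbrev OneSidedInv (K : Type*) [Field K] (n : ℕ) : Type _ :=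
  RingQuot (OneSidedInvRel K n)

/-- A two-sided ideal `P` of a (noncommutative) ring is prime if it is proper and, for two-sided
ideals `I` and `J`, `I * J ⊆ P` implies `I ⊆ P` or `J ⊆ P`. -/
def TwoSidedIdeal.IsPrimeIdeal {R : Type*} [Ring R] (P : TwoSidedIdeal R) : Prop :=
  P ≠ ⊤ ∧ ∀ I J : TwoSidedIdeal R, (∀ a ∈ I, ∀ b ∈ J, a * b ∈ P) → I ≤ P ∨ J ≤ P

/-- The sum `𝔞` of all the prime ideals of height one of a ring. The height of a prime ideal is
the supremum of the lengths of the chains of prime ideals that end in it. -/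
def sumHeightOnePrimes (R : Type*) [Ring R] : TwoSidedIdeal R :=
  ⨆ P : {P : TwoSidedIdeal R // P.IsPrimeIdeal}, ⨆ _ : Order.height P = 1, (P : TwoSidedIdeal R)

/-- The multiplicative monoid `1 + I` for a two-sided ideal `I`. -/
def TwoSidedIdeal.oneAdd {R : Type*} [Ring R] (I : TwoSidedIdeal R) : Submonoid R where
  carrier := {r | ∃ a ∈ I, r = 1 + a}
  one_mem' := ⟨0, I.zero_mem, by simp⟩
  mul_mem' := by
    rintro _ _ ⟨a, ha, rfl⟩ ⟨b, hb, rfl⟩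
    exact ⟨a + (b + a * b), I.add_mem ha (I.add_mem hb (I.mul_mem_left a b hb)), by noncomm_ring⟩

/-- The inner automorphism `ω_u : a ↦ u * a * u⁻¹` of an algebra, as a homomorphism in `u`. -/
def innerAut (K S : Type*) [Field K] [Ring S] [Algebra K S] : Sˣ →* (S ≃ₐ[K] S) where
  toFun u :=
    { toFun := fun a => u * a * (u⁻¹ : Sˣ)
      invFun := fun a => (u⁻¹ : Sˣ) * a * u
      left_inv := fun a => by simp [mul_assoc]
      right_inv := fun a => by simp [mul_assoc]
      map_mul' := fun a b => by simp [mul_assoc]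
      map_add' := fun a b => by simp [mul_add, add_mul]
      commutes' := fun k => by
        rw [← Algebra.commutes k (u : S), mul_assoc, Units.mul_inv, mul_one] }
  map_one' := by ext a; simp
  map_mul' u v := by ext a; simp [mul_assoc]

/-- The group `Inn(S)` of inner automorphisms of an algebra `S`. -/
def Inn (K S : Type*) [Field K] [Ring S] [Algebra K S] : Subgroup (S ≃ₐ[K] S) :=
  (innerAut K S).range

/-! The monomials `x ^ α * y ^ β` form a basis of `𝕊ₙ`, so `𝕊ₙ` is the monoid algebra of `n` copies
of the bicyclic monoid. For each set `T` of variables it acts on polynomials in the variables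
outside `T` with Laurent coefficients: variables in `T` act as scalars, the others as one-sided
shifts. The kernel `repKer K T` is generated by the idempotents `e j = 1 - x j * y j`, `j ∈ T`
(`repKer_le_iff`).

These kernels are prime because the image contains all matrix units over a domain. For `T = ∅` the
action is faithful with entries in `K`, so every nonzero ideal contains the product of all `e j`,
and a nonzero prime contains some `e j`. Hence the primes of height one are the `repKer K {j}`, and
`𝔞ₙ` is `repKer K univ`, the kernel of the map to Laurent polynomials.

A unit maps to a Laurent unit, that is, to a monomial `c * x ^ α`. With `T` the complement of `{i}`,
it then acts as the shift by `α i`, up to a factor, on all high powers of `x i`. An invertible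
operator cannot do so with `α i > 0`, by counting ranks (`eq_zero_of_eventually_shift`). The same
bound for the inverse gives `α = 0`, so units are nonzero scalars modulo `𝔞ₙ`.

Off-diagonal matrix units `E` lie in `𝔞ₙ` and square to zero, so `1 + E` is a unit in `1 + 𝔞ₙ`.
Whatever commutes with all of these is scalar. The assertions on centres and inner automorphisms
follow formally. -/

/-! ### The bicyclic monoid. -/

/-- The bicyclic monoid: the pair `(x, y)` stands for the monomial `X ^ x * Y ^ y`, where
`Y * X = 1`. -/
@[ext]
structure Bicyclic where
  /-- the exponent of `X` -/
  x : ℕ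
  /-- the exponent of `Y` -/
  y : ℕ

namespace Bicyclic

/-- Truncated subtraction encodes the cancellation `Y ^ p * X ^ q = X ^ (q - p) * Y ^ (p - q)`,
where at least one exponent is `0`. -/
instance : Monoid Bicyclic where
  mul a b := ⟨a.x + (b.x - a.y), b.y + (a.y - b.x)⟩
  one := ⟨0, 0⟩
  mul_assoc a b c := by
    refine Bicyclic.ext ?_ ?_
    · change a.x + (b.x - a.y) + (c.x - (b.y + (a.y - b.x))) =
        a.x + (b.x + (c.x - b.y) - a.y)
      omega
    · change c.y + (b.y + (a.y - b.x) - c.x) =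
        c.y + (b.y - c.x) + (a.y - (b.x + (c.x - b.y)))
      omega
  one_mul a := by
    refine Bicyclic.ext ?_ ?_
    · change 0 + (a.x - 0) = a.x
      omega
    · change a.y + (0 - a.x) = a.y
      omega
  mul_one a := by
    refine Bicyclic.ext ?_ ?_
    · change a.x + (0 - a.y) = a.x
      omega
    · change 0 + (a.y - 0) = a.y
      omega

@[simp] lemma mul_x (a b : Bicyclic) : (a * b).x = a.x + (b.x - a.y) := rfl
@[simp] lemma mul_y (a b : Bicyclic) : (a * b).y = b.y + (a.y - b.x) := rfl
@[simp] lemma one_x : (1 : Bicyclic).x = 0 := rfl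
@[simp] lemma one_y : (1 : Bicyclic).y = 0 := rfl

lemma x_pow (k : ℕ) : (⟨1, 0⟩ : Bicyclic) ^ k = ⟨k, 0⟩ := by
  induction k with
  | zero => rfl
  | succ k ih => rw [pow_succ, ih]; ext <;> simp

lemma y_pow (k : ℕ) : (⟨0, 1⟩ : Bicyclic) ^ k = ⟨0, k⟩ := by
  induction k with
  | zero => rfl
  | succ k ih => rw [pow_succ, ih]; ext <;> simp [add_comm]

lemma eq_pow_mul_pow (b : Bicyclic) : b = (⟨1, 0⟩ : Bicyclic) ^ b.x * (⟨0, 1⟩ : Bicyclic) ^ b.y := by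
  rw [x_pow, y_pow]; ext <;> simp

lemma pow_mul_pow_cancel {M : Type*} [Monoid M] {u v : M} (h : v * u = 1) (b c : ℕ) :
    v ^ b * u ^ c = u ^ (c - b) * v ^ (b - c) := by
  induction b generalizing c with
  | zero => simp
  | succ b ih =>
    cases c with
    | zero => simp
    | succ c =>
      rw [pow_succ, pow_succ' u, mul_assoc, ← mul_assoc v, h, one_mul, ih]
      simp

/-- A pair `u`, `v` with `v * u = 1` in a monoid gives a homomorphism of the bicyclic monoid. -/
def liftHom {M : Type*} [Monoid M] (u v : M) (h : v * u = 1) : Bicyclic →* M where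
  toFun b := u ^ b.x * v ^ b.y
  map_one' := by simp
  map_mul' a b := by
    rw [mul_assoc, ← mul_assoc (v ^ a.y), pow_mul_pow_cancel h, mul_x, mul_y, pow_add,
      add_comm b.y, pow_add]
    simp only [mul_assoc]

lemma liftHom_apply {M : Type*} [Monoid M] (u v : M) (h : v * u = 1) (b : Bicyclic) :
    liftHom u v h b = u ^ b.x * v ^ b.y := rfl

lemma hom_ext {M : Type*} [Monoid M] {f g : Bicyclic →* M} (hx : f ⟨1, 0⟩ = g ⟨1, 0⟩)
    (hy : f ⟨0, 1⟩ = g ⟨0, 1⟩) : f = g := by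
  ext b
  rw [eq_pow_mul_pow b]
  simp [hx, hy]

lemma pi_hom_ext {ι M : Type*} [Finite ι] [DecidableEq ι] [Monoid M] {f g : (ι → Bicyclic) →* M}
    (hx : ∀ i, f (Pi.mulSingle i ⟨1, 0⟩) = g (Pi.mulSingle i ⟨1, 0⟩))
    (hy : ∀ i, f (Pi.mulSingle i ⟨0, 1⟩) = g (Pi.mulSingle i ⟨0, 1⟩)) : f = g := by
  refine MonoidHom.pi_ext fun i b => ?_
  have h : f.comp (MonoidHom.mulSingle (fun _ : ι => Bicyclic) i) =
      g.comp (MonoidHom.mulSingle (fun _ : ι => Bicyclic) i) := hom_ext (hx i) (hy i)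
  exact DFunLike.congr_fun h b

end Bicyclic

/-! ### The monomial basis of `𝕊ₙ`. -/

section Presentation

variable (K : Type*) [Field K] (n : ℕ)

/-- The algebra of the monoid of monomials in the variables `x i`, `y i`. -/
abbrev MonomialAlg : Type _ := MonoidAlgebra K (Fin n → Bicyclic)

variable {n} in
/-- A generator of the algebra of one-sided inverses as a monomial. -/
def OneSidedInvGen.toMonomial : OneSidedInvGen n → (Fin n → Bicyclic)
  | .x i => Pi.mulSingle i ⟨1, 0⟩
  | .y i => Pi.mulSingle i ⟨0, 1⟩

/-- The homomorphism from the presented algebra to the algebra of monomials. -/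
noncomputable def OneSidedInv.toMonomialAlg : OneSidedInv K n →ₐ[K] MonomialAlg K n :=
  RingQuot.liftAlgHom K ⟨FreeAlgebra.lift K fun g => MonoidAlgebra.of K _ g.toMonomial, by
    intro a b h
    induction h with
    | y_mul_x i =>
      simp only [map_mul, FreeAlgebra.lift_ι_apply, map_one, OneSidedInvGen.toMonomial]
      rw [← map_mul, ← Pi.mulSingle_mul, ← map_one (MonoidAlgebra.of K (Fin n → Bicyclic)),
        ← Pi.mulSingle_one i]
      rfl
    | x_comm_y i j hij =>
      simp only [map_mul, FreeAlgebra.lift_ι_apply, OneSidedInvGen.toMonomial]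
      rw [← map_mul, ← map_mul, Pi.mulSingle_commute hij]
    | x_comm_x i j hij =>
      simp only [map_mul, FreeAlgebra.lift_ι_apply, OneSidedInvGen.toMonomial]
      rw [← map_mul, ← map_mul, Pi.mulSingle_commute hij]
    | y_comm_y i j hij =>
      simp only [map_mul, FreeAlgebra.lift_ι_apply, OneSidedInvGen.toMonomial]
      rw [← map_mul, ← map_mul, Pi.mulSingle_commute hij]⟩

variable {n} in
/-- The image of a generator in the presented algebra. -/
noncomputable def OneSidedInv.gen (g : OneSidedInvGen n) : OneSidedInv K n :=
  RingQuot.mkAlgHom K _ (FreeAlgebra.ι K g)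

lemma OneSidedInv.gen_y_mul_gen_x (i : Fin n) : gen K (.y i) * gen K (.x i) = 1 := by
  rw [gen, gen, ← map_mul, RingQuot.mkAlgHom_rel K (OneSidedInvRel.y_mul_x i), map_one]

lemma OneSidedInv.commute_gen {i j : Fin n} (hij : i ≠ j) :
    Commute (gen K (.x i)) (gen K (.x j)) ∧ Commute (gen K (.x i)) (gen K (.y j)) ∧
      Commute (gen K (.y i)) (gen K (.y j)) := by
  simp only [Commute, SemiconjBy, gen, ← map_mul]
  exact ⟨RingQuot.mkAlgHom_rel K (.x_comm_x i j hij), RingQuot.mkAlgHom_rel K (.x_comm_y i j hij),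
    RingQuot.mkAlgHom_rel K (.y_comm_y i j hij)⟩

/-- The homomorphism from the monoid of monomials to the presented algebra. -/
noncomputable def OneSidedInv.ofMonomial : (Fin n → Bicyclic) →* OneSidedInv K n :=
  MonoidHom.noncommPiCoprod
    (fun i => Bicyclic.liftHom (gen K (.x i)) (gen K (.y i)) (gen_y_mul_gen_x K n i)) (by
      intro i j hij a b
      obtain ⟨hxx, hxy, hyy⟩ := commute_gen K n hij
      have hyx := (commute_gen K n hij.symm).2.1.symm
      exact ((hxx.pow_pow _ _).mul_right (hxy.pow_pow _ _)).mul_left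
        ((hyx.pow_pow _ _).mul_right (hyy.pow_pow _ _)))

/-- The algebra of one-sided inverses has the monomials `x ^ α * y ^ β` as a basis. -/
noncomputable def OneSidedInv.equivMonomialAlg : OneSidedInv K n ≃ₐ[K] MonomialAlg K n :=
  AlgEquiv.ofAlgHom (toMonomialAlg K n)
    (MonoidAlgebra.lift K (OneSidedInv K n) (Fin n → Bicyclic) (ofMonomial K n))
    (by
      refine MonoidAlgebra.algHom_ext' ?_ (by ext)
      refine Bicyclic.pi_hom_ext (fun i => ?_) fun i => ?_
      · simp [ofMonomial, Bicyclic.liftHom_apply, gen, toMonomialAlg, OneSidedInvGen.toMonomial]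
      · simp [ofMonomial, Bicyclic.liftHom_apply, gen, toMonomialAlg, OneSidedInvGen.toMonomial])
    (by
      refine RingQuot.ringQuot_ext' _ _ _ ?_
      refine FreeAlgebra.hom_ext ?_
      funext g
      cases g <;>
        simp [ofMonomial, Bicyclic.liftHom_apply, gen, toMonomialAlg, OneSidedInvGen.toMonomial])

end Presentation

/-! ### Representations with Laurent coefficients and their kernels. -/

section Representation

variable (K : Type*) [Field K] {n : ℕ} (T : Finset (Fin n))

/-- The Laurent polynomial algebra in `n` variables. -/
abbrev LaurentAlg (K : Type*) [Field K] (n : ℕ) : Type _ :=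
  MonoidAlgebra K (Multiplicative (Fin n → ℤ))

namespace MonomialAlg

/-- The exponents of polynomials in the variables outside `T`. -/
abbrev Index {n : ℕ} (T : Finset (Fin n)) : Type := {j // j ∉ T} → ℕ

/-- The degree of a monomial in the variables in `T`. -/
def degHom : (Fin n → Bicyclic) →* Multiplicative (Fin n → ℤ) where
  toFun b := Multiplicative.ofAdd fun j => if j ∈ T then ((b j).x : ℤ) - (b j).y else 0
  map_one' := by
    rw [← ofAdd_zero]
    congr 1
    ext j
    simp
  map_mul' a b := by
    rw [← ofAdd_add]
    congr 1
    ext j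
    simp only [Pi.mul_apply, Bicyclic.mul_x, Bicyclic.mul_y, Pi.add_apply]
    split_ifs <;> omega

/-- The effect of a monomial on exponents, where it does not vanish. -/
def shift {T : Finset (Fin n)} (b : Fin n → Bicyclic) (m : Index T) : Index T :=
  fun j => m j - (b j).y + (b j).x

/-- A monomial acts on polynomials in the variables outside `T`, over the Laurent polynomials. -/
noncomputable def actFun (b : Fin n → Bicyclic) :
    Module.End (LaurentAlg K n) (Index T →₀ LaurentAlg K n) :=
  Finsupp.linearCombination (LaurentAlg K n) fun m => if ∀ j : {j // j ∉ T}, (b j).y ≤ m j then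
    Finsupp.single (shift b m) (MonoidAlgebra.single (degHom T b) 1) else 0

lemma actFun_single (b : Fin n → Bicyclic) (m : Index T) (r : LaurentAlg K n) :
    actFun K T b (Finsupp.single m r) = if ∀ j : {j // j ∉ T}, (b j).y ≤ m j then
      Finsupp.single (shift b m) (r * MonoidAlgebra.single (degHom T b) 1) else 0 := by
  rw [actFun, Finsupp.linearCombination_single]
  split_ifs <;> simp

/-- The action of the monoid of monomials on polynomials in the variables outside `T`. -/
noncomputable def actHom :
    (Fin n → Bicyclic) →* Module.End (LaurentAlg K n) (Index T →₀ LaurentAlg K n) where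
  toFun := actFun K T
  map_one' := by
    refine Finsupp.lhom_ext fun m r => ?_
    have : shift (1 : Fin n → Bicyclic) m = m := by ext j; simp [shift]
    rw [actFun_single, if_pos (by simp), this, map_one, ← MonoidAlgebra.one_def, mul_one]
    rfl
  map_mul' a b := by
    refine Finsupp.lhom_ext fun m r => ?_
    rw [Module.End.mul_apply, actFun_single, actFun_single]
    by_cases hb : ∀ j : {j // j ∉ T}, (b j).y ≤ m j
    · rw [if_pos hb, actFun_single]
      by_cases ha : ∀ j : {j // j ∉ T}, (a j).y ≤ shift b m j
      · rw [if_pos ha, if_pos]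
        · have : shift (a * b) m = shift a (shift b m) := by
            ext j
            have h1 := ha j
            have h2 := hb j
            simp only [shift, Pi.mul_apply, Bicyclic.mul_x, Bicyclic.mul_y] at h1 ⊢
            omega
          rw [this, mul_assoc, MonoidAlgebra.single_mul_single, mul_one, map_mul,
            mul_comm (degHom T a)]
        · intro j
          have h1 := ha j
          have h2 := hb j
          simp only [shift, Pi.mul_apply, Bicyclic.mul_y] at h1 ⊢
          omega
      · rw [if_neg ha, if_neg]
        contrapose! ha
        intro j
        have h1 := ha j
        have h2 := hb j
        simp only [shift, Pi.mul_apply, Bicyclic.mul_y] at h1 ⊢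
        omega
    · rw [if_neg hb, map_zero, if_neg]
      contrapose! hb
      intro j
      have h1 := hb j
      simp only [Pi.mul_apply, Bicyclic.mul_y] at h1
      omega

/-- The representation of the algebra of monomials on polynomials in the variables outside `T` over
the Laurent polynomials; the variables in `T` act as scalars. -/
noncomputable def rep :
    MonomialAlg K n →ₐ[K] Module.End (LaurentAlg K n) (Index T →₀ LaurentAlg K n) :=
  MonoidAlgebra.lift K _ _ (actHom K T)

variable {K} in
lemma eq_sum_single (a : MonomialAlg K n) :
    a = ∑ b ∈ a.coeff.support, MonoidAlgebra.single b (a.coeff b) := by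
  ext1
  rw [MonoidAlgebra.coeff_sum]
  exact a.coeff.sum_single.symm

lemma rep_single (b : Fin n → Bicyclic) (c : K) (m : Index T) (r : LaurentAlg K n) :
    rep K T (MonoidAlgebra.single b c) (Finsupp.single m r) =
      if ∀ j : {j // j ∉ T}, (b j).y ≤ m j then
        Finsupp.single (shift b m) (r * MonoidAlgebra.single (degHom T b) c) else 0 := by
  rw [rep, MonoidAlgebra.lift_single, LinearMap.smul_apply]
  refine (congrArg (c • ·) (actFun_single K T b m r)).trans ?_
  split_ifs
  · rw [Finsupp.smul_single, ← mul_smul_comm, MonoidAlgebra.smul_single, smul_eq_mul, mul_one]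
  · simp

lemma rep_apply_single (a : MonomialAlg K n) (m : Index T) (r : LaurentAlg K n) :
    rep K T a (Finsupp.single m r) = ∑ b ∈ a.coeff.support,
      if ∀ j : {j // j ∉ T}, (b j).y ≤ m j then
        Finsupp.single (shift b m) (r * MonoidAlgebra.single (degHom T b) (a.coeff b)) else 0 := by
  conv_lhs => rw [eq_sum_single a]
  simp only [map_sum, LinearMap.sum_apply, rep_single]

/-- The kernel of the representation on polynomials in the variables outside `T`. -/
noncomputable def repKer : TwoSidedIdeal (MonomialAlg K n) := TwoSidedIdeal.ker (rep K T)

lemma mem_repKer {a : MonomialAlg K n} : a ∈ repKer K T ↔ rep K T a = 0 :=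
  TwoSidedIdeal.mem_ker _

/-- A monomial in which no variable in `T` occurs together with its one-sided inverse. -/
def Reduced (b : Fin n → Bicyclic) : Prop := ∀ j ∈ T, (b j).x = 0 ∨ (b j).y = 0

variable {K T} in
-- A reduced monomial is determined by its degree in `T` and its exponents outside `T`, so a
-- suitable matrix entry of `g` isolates a single coefficient.
lemma eq_zero_of_reduced {g : MonomialAlg K n} (hg : ∀ b ∈ g.coeff.support, Reduced T b)
    (h : rep K T g = 0) : g = 0 := by
  by_contra hne
  have hs : g.coeff.support.Nonempty := by
    rw [Finsupp.support_nonempty_iff]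
    simpa using hne
  let f : (Fin n → Bicyclic) → Index T := fun b j => (b j).y
  obtain ⟨b₀, hb₀, hmin⟩ := g.coeff.support.exists_minimalFor f hs
  -- Only monomials with `y`-exponents at most those of `b₀` survive on `f b₀`. By minimality theirs
  -- are equal to those of `b₀`, and then the target exponent and the degree leave `b₀` alone.
  have h0 : (rep K T g (Finsupp.single (f b₀) 1)
      fun j : {j // j ∉ T} => (b₀ j).x).coeff (degHom T b₀) = 0 := by
    rw [h]
    simp
  rw [rep_apply_single, Finsupp.finsetSum_apply, MonoidAlgebra.coeff_sum, Finsupp.finsetSum_apply,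
    Finset.sum_eq_single b₀] at h0
  · have hs : shift b₀ (f b₀) = fun j : {j // j ∉ T} => (b₀ j).x := by ext j; simp [shift, f]
    rw [if_pos fun j => le_rfl, hs] at h0
    simp only [one_mul, Finsupp.single_eq_same, MonoidAlgebra.coeff_single] at h0
    exact (Finsupp.mem_support_iff.mp hb₀) h0
  · intro b hb hbb
    split_ifs with hle
    · have hfe : ∀ j : {j // j ∉ T}, (b₀ j).y = (b j).y := fun j =>
        le_antisymm (hmin hb hle j) (hle j)
      by_contra hcon
      apply hbb
      have h1 : shift b (f b₀) = fun j : {j // j ∉ T} => (b₀ j).x := by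
        by_contra h1
        simp [h1] at hcon
      rw [h1] at hcon
      have h2 : degHom T b = degHom T b₀ := by
        by_contra h2
        simp [h2] at hcon
      have h2' : ∀ j, (if j ∈ T then ((b j).x : ℤ) - (b j).y else 0) =
        if j ∈ T then ((b₀ j).x : ℤ) - (b₀ j).y else 0 := congrFun (Multiplicative.ofAdd.injective h2)
      funext j
      by_cases hj : j ∈ T
      · have h3 := h2' j
        simp only [hj, if_true] at h3
        have h4 := hg b hb j hj
        have h5 := hg b₀ hb₀ j hj
        ext <;> omega
      · have h3 := congrFun h1 ⟨j, hj⟩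
        have h4 := hfe ⟨j, hj⟩
        simp only [shift, f] at h3 h4
        ext <;> omega
    · simp
  · intro h; exact absurd hb₀ h

/-- The idempotent `1 - x j * y j`. -/
noncomputable def idem (j : Fin n) : MonomialAlg K n :=
  1 - MonoidAlgebra.single (Pi.mulSingle j ⟨1, 1⟩) 1

variable {K T} in
lemma exists_reduced_monomial {I : TwoSidedIdeal (MonomialAlg K n)} (hI : ∀ j ∈ T, idem K j ∈ I)
    (b : Fin n → Bicyclic) : ∃ b', Reduced T b' ∧
      MonoidAlgebra.single b (1 : K) - MonoidAlgebra.single b' 1 ∈ I := by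
  induction hN : ∑ j, (b j).x using Nat.strong_induction_on generalizing b with
  | _ N ih =>
  by_cases hb : Reduced T b
  · exact ⟨b, hb, by rw [sub_self]; exact I.zero_mem⟩
  simp only [Reduced, not_forall, not_or] at hb
  obtain ⟨j, hj, hx, hy⟩ := hb
  -- Factor `b` as `u * (x j * y j) * v`. Dropping the middle factor changes `b` by an element of
  -- `I` and lowers the total `x`-exponent.
  let u : Fin n → Bicyclic := fun i => ⟨(b i).x - if i = j then 1 else 0, 0⟩
  let v : Fin n → Bicyclic := fun i => ⟨0, (b i).y - if i = j then 1 else 0⟩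
  have hlt : ∑ i, ((u * v) i).x < N := by
    rw [← hN]
    refine Finset.sum_lt_sum (fun i _ => by simp [u, v]) ⟨j, Finset.mem_univ j, ?_⟩
    simp [u, v]
    omega
  obtain ⟨b', hb', hI'⟩ := ih _ hlt (u * v) rfl
  refine ⟨b', hb', ?_⟩
  have hbuv : u * Pi.mulSingle j ⟨1, 1⟩ * v = b := by
    funext i
    by_cases hij : i = j
    · subst hij
      ext <;> simp [u, v] <;> omega
    · ext <;> simp [u, v, hij]
  have hkey : MonoidAlgebra.single b (1 : K) - MonoidAlgebra.single b' 1 =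
      -(MonoidAlgebra.single u 1 * idem K j * MonoidAlgebra.single v 1) +
        (MonoidAlgebra.single (u * v) (1 : K) - MonoidAlgebra.single b' 1) := by
    simp only [idem, mul_sub, sub_mul, mul_one, MonoidAlgebra.single_mul_single, hbuv]
    abel
  rw [hkey]
  exact I.add_mem (I.neg_mem (I.mul_mem_right _ _ (I.mul_mem_left _ _ (hI j hj)))) hI'

variable {K T} in
lemma exists_reduced {I : TwoSidedIdeal (MonomialAlg K n)} (hI : ∀ j ∈ T, idem K j ∈ I)
    (a : MonomialAlg K n) :
    ∃ g : MonomialAlg K n, (∀ b ∈ g.coeff.support, Reduced T b) ∧ a - g ∈ I := by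
  classical
  choose f hf hfI using exists_reduced_monomial (K := K) hI
  refine ⟨∑ b ∈ a.coeff.support, MonoidAlgebra.single (f b) (a.coeff b), fun b hb => ?_, ?_⟩
  · rw [MonoidAlgebra.coeff_sum] at hb
    obtain ⟨c, -, hc⟩ := Finset.mem_biUnion.mp (Finsupp.support_finsetSum hb)
    rw [MonoidAlgebra.coeff_single] at hc
    rw [Finset.mem_singleton.mp (Finsupp.support_single_subset hc)]
    exact hf c
  · have h : a = ∑ b ∈ a.coeff.support, MonoidAlgebra.single b (a.coeff b) := by
      ext1
      rw [MonoidAlgebra.coeff_sum]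
      exact a.coeff.sum_single.symm
    rw [← sub_eq_zero] at h
    nth_rewrite 1 [sub_eq_zero.mp h]
    rw [← Finset.sum_sub_distrib]
    refine I.finsetSum_mem _ _ fun b _ => ?_
    convert I.mul_mem_left (MonoidAlgebra.single 1 (a.coeff b)) _ (hfI b) using 1
    simp [mul_sub, MonoidAlgebra.single_mul_single]

lemma shift_mulSingle {j : Fin n} (m : Index T) (hm : ∀ h : j ∉ T, m ⟨j, h⟩ ≠ 0) :
    shift (Pi.mulSingle j ⟨1, 1⟩) m = m := by
  ext i
  by_cases hij : i = j
  · have := hm (hij ▸ i.2)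
    have hi : i = ⟨j, hij ▸ i.2⟩ := Subtype.ext hij
    rw [← hi] at this
    simp [shift, hij]
    omega
  · simp [shift, hij]

lemma degHom_mulSingle (j : Fin n) : degHom T (Pi.mulSingle j ⟨1, 1⟩) = 1 := by
  rw [← ofAdd_zero]
  refine congrArg Multiplicative.ofAdd ?_
  ext i
  by_cases hij : i = j
  · subst hij; simp
  · simp [hij]

lemma rep_idem_of_mem {j : Fin n} (hj : j ∈ T) : rep K T (idem K j) = 0 := by
  refine Finsupp.lhom_ext fun m r => ?_
  rw [idem, map_sub, map_one, LinearMap.sub_apply, rep_single, if_pos, shift_mulSingle,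
    degHom_mulSingle, ← MonoidAlgebra.one_def, mul_one]
  · simp
  · exact fun h => absurd hj h
  · intro i
    have : (i : Fin n) ≠ j := fun h => i.2 (h ▸ hj)
    simp [this]

lemma rep_idem_of_notMem {j : Fin n} (hj : j ∉ T) (m : Index T) (r : LaurentAlg K n) :
    rep K T (idem K j) (Finsupp.single m r) = if m ⟨j, hj⟩ = 0 then Finsupp.single m r else 0 := by
  rw [idem, map_sub, map_one, LinearMap.sub_apply, rep_single, Module.End.one_apply]
  by_cases hm : m ⟨j, hj⟩ = 0
  · rw [if_pos hm, if_neg, sub_zero]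
    intro h
    have := h ⟨j, hj⟩
    simp [hm] at this
  · rw [if_neg hm, if_pos, shift_mulSingle _ _ fun _ => hm, degHom_mulSingle,
      ← MonoidAlgebra.one_def, mul_one, sub_self]
    intro i
    by_cases hij : (i : Fin n) = j
    · have hi : i = ⟨j, hj⟩ := Subtype.ext hij
      rw [← hi] at hm
      simp [hij]
      omega
    · simp [hij]

variable {K T} in
/-- The kernel of the representation is generated by the idempotents `1 - x j * y j`, `j ∈ T`. -/
lemma repKer_le_iff {I : TwoSidedIdeal (MonomialAlg K n)} :
    repKer K T ≤ I ↔ ∀ j ∈ T, idem K j ∈ I := by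
  refine ⟨fun h j hj => h ((mem_repKer K T).mpr (rep_idem_of_mem K T hj)), fun hI a ha => ?_⟩
  -- Reducing modulo the intersection puts the remainder `g` in the kernel as well, so it vanishes.
  obtain ⟨g, hg, hag⟩ := exists_reduced (I := I ⊓ repKer K T) (fun j hj =>
    (TwoSidedIdeal.mem_inf _).mpr ⟨hI j hj, (mem_repKer K T).mpr (rep_idem_of_mem K T hj)⟩) a
  rw [TwoSidedIdeal.mem_inf] at hag
  have hg0 : rep K T g = 0 := by
    have h1 := (mem_repKer K T).mp hag.2
    rw [map_sub, (mem_repKer K T).mp ha] at h1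
    simpa using h1
  have := eq_zero_of_reduced hg hg0
  simpa [this] using hag.1

lemma repKer_empty : repKer K (∅ : Finset (Fin n)) = ⊥ :=
  le_bot_iff.mp (repKer_le_iff.mpr (by simp))

end MonomialAlg

end Representation

/-! ### Prime ideals and the primes of height one. -/

/-- Two annihilator-type ideals stand in for those generated by `a` and `b`: `J` collects the `y`
with `a * R * y ⊆ P`, and `I` the `x` with `x * J ⊆ P`. -/
lemma TwoSidedIdeal.IsPrimeIdeal.mem_or_mem {R : Type*} [Ring R] {P : TwoSidedIdeal R}
    (hP : P.IsPrimeIdeal) {a b : R} (h : ∀ c, a * c * b ∈ P) : a ∈ P ∨ b ∈ P := by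
  let J : TwoSidedIdeal R := .mk' {y | ∀ c, a * c * y ∈ P}
    (fun c => by simp)
    (fun {x y} hx hy c => by rw [mul_add]; exact P.add_mem (hx c) (hy c))
    (fun {x} hx c => by rw [mul_neg]; exact P.neg_mem (hx c))
    (fun {x y} hy c => by rw [← mul_assoc, mul_assoc a]; exact hy (c * x))
    (fun {x y} hx c => by rw [← mul_assoc]; exact P.mul_mem_right _ _ (hx c))
  have hJ : ∀ y, y ∈ J ↔ ∀ c, a * c * y ∈ P := fun y => TwoSidedIdeal.mem_mk' _ _ _ _ _ _ _
  let I : TwoSidedIdeal R := .mk' {x | ∀ y ∈ J, x * y ∈ P}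
    (fun y _ => by simp)
    (fun {x x'} hx hx' y hy => by rw [add_mul]; exact P.add_mem (hx y hy) (hx' y hy))
    (fun {x} hx y hy => by rw [neg_mul]; exact P.neg_mem (hx y hy))
    (fun {x x'} hx y hy => by rw [mul_assoc]; exact P.mul_mem_left _ _ (hx y hy))
    (fun {x x'} hx y hy => by rw [mul_assoc]; exact hx _ (J.mul_mem_left _ _ hy))
  have hI : ∀ x, x ∈ I ↔ ∀ y ∈ J, x * y ∈ P := fun x => TwoSidedIdeal.mem_mk' _ _ _ _ _ _ _
  have haI : a ∈ I := (hI a).mpr fun y hy => by simpa using (hJ y).mp hy 1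
  have hbJ : b ∈ J := (hJ b).mpr h
  rcases hP.2 I J (fun x hx y hy => (hI x).mp hx y hy) with hle | hle
  · exact Or.inl (hle haI)
  · exact Or.inr (hle hbJ)

section Primes

variable (K : Type*) [Field K] {n : ℕ} (T : Finset (Fin n))

namespace MonomialAlg

variable {K} in
lemma commute_single_idem {b : Fin n → Bicyclic} {j : Fin n} (hb : b j = 1) (c : K) :
    Commute (MonoidAlgebra.single b c) (idem K j) := by
  refine (Commute.one_right _).sub_right ?_
  have h : b * Pi.mulSingle j ⟨1, 1⟩ = Pi.mulSingle j ⟨1, 1⟩ * b := by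
    funext i
    by_cases hij : i = j
    · subst hij; simp [hb]
    · simp [hij]
  rw [Commute, SemiconjBy, MonoidAlgebra.single_mul_single, MonoidAlgebra.single_mul_single, h,
    mul_one, one_mul]

lemma commute_idem (i j : Fin n) : Commute (idem K i) (idem K j) := by
  by_cases hij : i = j
  · rw [hij]
  · refine (Commute.one_left _).sub_left (commute_single_idem ?_ 1)
    simp [Ne.symm hij]

/-- The product of the idempotents `1 - x j * y j`. -/
noncomputable def idemProd (s : Finset (Fin n)) : MonomialAlg K n :=
  s.noncommProd (idem K) fun i _ j _ _ => commute_idem K i j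

lemma idemProd_empty : idemProd K (∅ : Finset (Fin n)) = 1 := Finset.noncommProd_empty _ _

lemma idemProd_insert {s : Finset (Fin n)} {j : Fin n} (hj : j ∉ s) :
    idemProd K (insert j s) = idem K j * idemProd K s :=
  Finset.noncommProd_insert_of_notMem _ _ _ _ hj

lemma idemProd_mem {I : TwoSidedIdeal (MonomialAlg K n)} {s : Finset (Fin n)} {j : Fin n}
    (hj : j ∈ s) (h : idem K j ∈ I) : idemProd K s ∈ I := by
  rw [← Finset.insert_erase hj, idemProd_insert K (Finset.notMem_erase j s)]
  exact I.mul_mem_right _ _ h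

variable {K} in
-- A monomial splits into a part free of variable `j`, which commutes with `idem K j`, and a part in
-- variable `j` alone, which commutes with `idemProd K s`. Both move to the outside.
lemma idem_mul_mul_idemProd_mem {I : TwoSidedIdeal (MonomialAlg K n)} {s : Finset (Fin n)}
    {j : Fin n} (hj : j ∉ s) (h : idem K j * idemProd K s ∈ I) (c : MonomialAlg K n) :
    idem K j * c * idemProd K s ∈ I := by
  rw [eq_sum_single c, Finset.mul_sum, Finset.sum_mul]
  refine I.finsetSum_mem _ _ fun b _ => ?_
  have hb : MonoidAlgebra.single b (c.coeff b) =
      MonoidAlgebra.single (Function.update b j 1) (c.coeff b) *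
        MonoidAlgebra.single (Pi.mulSingle j (b j)) 1 := by
    rw [MonoidAlgebra.single_mul_single, mul_one]
    congr 1
    funext i
    by_cases hij : i = j
    · subst hij; simp
    · simp [hij]
  have h1 : Commute (MonoidAlgebra.single (Function.update b j 1) (c.coeff b)) (idem K j) :=
    commute_single_idem (by simp) _
  have h2 : Commute (MonoidAlgebra.single (Pi.mulSingle j (b j)) (1 : K)) (idemProd K s) :=
    Finset.noncommProd_commute _ _ _ _ fun i hi =>
      commute_single_idem (by simp [show i ≠ j from fun h => hj (h ▸ hi)]) _
  rw [hb, ← mul_assoc, ← h1.eq, mul_assoc, mul_assoc, h2.eq, ← mul_assoc (idem K j)]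
  exact I.mul_mem_left _ _ (I.mul_mem_right _ _ h)

variable {K} in
lemma exists_idem_mem {P : TwoSidedIdeal (MonomialAlg K n)} (hP : P.IsPrimeIdeal)
    (s : Finset (Fin n)) (h : idemProd K s ∈ P) : ∃ j ∈ s, idem K j ∈ P := by
  induction s using Finset.induction_on with
  | empty =>
    refine absurd ((TwoSidedIdeal.one_mem_iff P).mp ?_) hP.1
    rwa [idemProd_empty] at h
  | insert j s hj ih =>
    rw [idemProd_insert K hj] at h
    rcases hP.mem_or_mem (idem_mul_mul_idemProd_mem hj h) with h | h
    · exact ⟨j, Finset.mem_insert_self j s, h⟩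
    · obtain ⟨i, hi, hiP⟩ := ih h
      exact ⟨i, Finset.mem_insert_of_mem hi, hiP⟩

lemma rep_idemProd (s : Finset (Fin n)) (hs : ∀ j ∈ s, j ∉ T) (m : Index T) (r : LaurentAlg K n) :
    rep K T (idemProd K s) (Finsupp.single m r) =
      if ∀ j : {j // j ∉ T}, (j : Fin n) ∈ s → m j = 0 then Finsupp.single m r else 0 := by
  induction s using Finset.induction_on with
  | empty => simp [idemProd_empty]
  | insert i s hi ih =>
    rw [idemProd_insert K hi, map_mul, Module.End.mul_apply,
      ih fun j hj => hs j (Finset.mem_insert_of_mem hj)]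
    by_cases h1 : ∀ j : {j // j ∉ T}, (j : Fin n) ∈ s → m j = 0
    · rw [if_pos h1, rep_idem_of_notMem K T (hs i (Finset.mem_insert_self i s))]
      refine if_congr ⟨fun h j hj => ?_, fun h => h _ (Finset.mem_insert_self i s)⟩ rfl rfl
      rcases Finset.mem_insert.mp hj with hj | hj
      · rwa [show j = ⟨i, hs i (Finset.mem_insert_self i s)⟩ from Subtype.ext hj]
      · exact h1 j hj
    · rw [if_neg h1, map_zero, if_neg]
      exact fun h => h1 fun j hj => h j (Finset.mem_insert_of_mem hj)

variable {T} in
/-- The monomial `x ^ m` in the variables outside `T`. -/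
def xMon (m : Index T) : Fin n → Bicyclic := fun j => if h : j ∉ T then ⟨m ⟨j, h⟩, 0⟩ else 1

variable {T} in
/-- The monomial `y ^ m` in the variables outside `T`. -/
def yMon (m : Index T) : Fin n → Bicyclic := fun j => if h : j ∉ T then ⟨0, m ⟨j, h⟩⟩ else 1

variable {T} in
/-- The matrix unit `x ^ m * ∏ (1 - x j * y j) * y ^ k`, over the variables outside `T`. -/
noncomputable def matrixUnit (m k : Index T) : MonomialAlg K n :=
  MonoidAlgebra.single (xMon m) 1 * idemProd K Tᶜ * MonoidAlgebra.single (yMon k) 1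

variable {T} in
lemma xMon_apply (m : Index T) (j : {j // j ∉ T}) : xMon m j = ⟨m j, 0⟩ := dif_pos j.2

variable {T} in
lemma yMon_apply (m : Index T) (j : {j // j ∉ T}) : yMon m j = ⟨0, m j⟩ := dif_pos j.2

variable {T} in
lemma degHom_eq_one {b : Fin n → Bicyclic} (hb : ∀ j ∈ T, b j = 1) : degHom T b = 1 := by
  rw [← ofAdd_zero]
  refine congrArg Multiplicative.ofAdd ?_
  ext j
  by_cases hj : j ∈ T
  · simp [hb j hj]
  · simp [hj]

variable {T} in
-- `y ^ k` kills `x ^ l` unless `k ≤ l` and otherwise yields `x ^ (l - k)`; the idempotents keep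
-- only exponent `0`, and `x ^ m` moves it to `m`.
lemma rep_matrixUnit (m k : Index T) :
    rep K T (matrixUnit K m k) = (Finsupp.lsingle m).comp (Finsupp.lapply k) := by
  refine Finsupp.lhom_ext fun l r => ?_
  rw [matrixUnit, map_mul, map_mul, Module.End.mul_apply, Module.End.mul_apply, rep_single,
    degHom_eq_one fun j hj => dif_neg (not_not.mpr hj), ← MonoidAlgebra.one_def, mul_one,
    LinearMap.comp_apply, Finsupp.lapply_apply, Finsupp.lsingle_apply]
  by_cases hkl : k ≤ l
  · have hs : shift (yMon k) l = l - k := by ext j; simp [shift, yMon_apply]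
    rw [if_pos fun j => by rw [yMon_apply]; exact hkl j, hs,
      rep_idemProd K T _ fun j hj => Finset.mem_compl.mp hj]
    by_cases h : l = k
    · rw [if_pos fun j _ => by simp [h], rep_single,
        degHom_eq_one fun j hj => dif_neg (not_not.mpr hj), ← MonoidAlgebra.one_def, mul_one,
        if_pos fun j => by simp [xMon_apply]]
      have : shift (xMon m) (l - k) = m := by ext j; simp [shift, xMon_apply, h]
      rw [this, h, Finsupp.single_eq_same]
    · rw [if_neg, map_zero, Finsupp.single_eq_of_ne (Ne.symm h), Finsupp.single_zero]
      intro h0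
      refine h (le_antisymm (fun j => ?_) hkl)
      exact Nat.sub_eq_zero_iff_le.mp (h0 j (Finset.mem_compl.mpr j.2))
  · rw [if_neg, map_zero, map_zero, Finsupp.single_eq_of_ne, Finsupp.single_zero]
    · rintro rfl; exact hkl le_rfl
    · exact fun h => hkl fun j => by have := h j; rwa [yMon_apply] at this

variable {K T} in
lemma exists_coeff_ne_zero {a : MonomialAlg K n} (ha : a ∉ repKer K T) :
    ∃ m m' : Index T, rep K T a (Finsupp.single m 1) m' ≠ 0 := by
  by_contra! h
  refine ha ((mem_repKer K T).mpr (Finsupp.lhom_ext' fun m => LinearMap.ext_ring ?_))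
  ext1 m'
  exact h m m'

lemma idem_mem_repKer {j : Fin n} : idem K j ∈ repKer K T ↔ j ∈ T := by
  refine ⟨fun h => ?_, fun h => (mem_repKer K T).mpr (rep_idem_of_mem K T h)⟩
  by_contra hj
  have h1 := rep_idem_of_notMem K T hj 0 1
  rw [(mem_repKer K T).mp h, if_pos (show (0 : Index T) ⟨j, hj⟩ = 0 from rfl),
    LinearMap.zero_apply] at h1
  exact one_ne_zero (Finsupp.single_eq_zero.mp h1.symm)

lemma repKer_le_repKer {S T : Finset (Fin n)} : repKer K S ≤ repKer K T ↔ S ⊆ T := by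
  simp only [repKer_le_iff, idem_mem_repKer, Finset.subset_iff]

/-- If `a` and `b` have nonzero entries at `(m', m)` and `(k', k)`, then `a * E * b`, with `E` the
matrix unit at `(m, k')`, has their product as its `(m', k)` entry, nonzero because Laurent
polynomials form a domain. -/
lemma isPrimeIdeal_repKer : (repKer K T).IsPrimeIdeal := by
  refine ⟨fun h => ?_, fun I J h => ?_⟩
  · have h1 := (mem_repKer K T).mp ((TwoSidedIdeal.one_mem_iff _).mpr h)
    have h2 := LinearMap.congr_fun h1 (Finsupp.single 0 1)
    rw [map_one, Module.End.one_apply, LinearMap.zero_apply, Finsupp.single_eq_zero] at h2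
    exact one_ne_zero h2
  · by_contra! hc
    obtain ⟨a, haI, ha⟩ := Set.not_subset.mp hc.1
    obtain ⟨b, hbJ, hb⟩ := Set.not_subset.mp hc.2
    obtain ⟨m, m', hm⟩ := exists_coeff_ne_zero ha
    obtain ⟨k, k', hk⟩ := exists_coeff_ne_zero hb
    have h1 := (mem_repKer K T).mp
      (h a haI (matrixUnit K m k' * b) (J.mul_mem_left _ _ hbJ))
    have h2 := DFunLike.congr_fun (LinearMap.congr_fun h1 (Finsupp.single k 1)) m'
    rw [map_mul, map_mul, Module.End.mul_apply, Module.End.mul_apply, rep_matrixUnit,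
      LinearMap.comp_apply, Finsupp.lapply_apply, Finsupp.lsingle_apply,
      ← mul_one (rep K T b (Finsupp.single k 1) k'), ← smul_eq_mul, ← Finsupp.smul_single, map_smul,
      Finsupp.smul_apply, smul_eq_mul, LinearMap.zero_apply, Finsupp.zero_apply] at h2
    exact (mul_ne_zero hk hm) h2

/-- For `T = ∅` all degrees are trivial. That entries lie in the field lets a nonzero one be
inverted below. -/
lemma exists_rep_empty_apply (a : MonomialAlg K n) (m m' : Index (∅ : Finset (Fin n))) :
    ∃ c : K, rep K ∅ a (Finsupp.single m 1) m' = algebraMap K (LaurentAlg K n) c := by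
  suffices h : rep K ∅ a (Finsupp.single m 1) m' ∈ (algebraMap K (LaurentAlg K n)).range by
    obtain ⟨c, hc⟩ := h
    exact ⟨c, hc.symm⟩
  rw [rep_apply_single, Finsupp.finsetSum_apply]
  refine Subring.sum_mem _ fun b _ => ?_
  split_ifs
  · rw [Finsupp.single_apply]
    split_ifs
    · exact ⟨a.coeff b, by simp [degHom_eq_one]⟩
    · exact Subring.zero_mem _
  · exact Subring.zero_mem _

lemma rep_injective : Function.Injective (rep K (∅ : Finset (Fin n))) :=
  (TwoSidedIdeal.ker_eq_bot _).mp (repKer_empty K)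

lemma matrixUnit_zero : matrixUnit K (0 : Index (∅ : Finset (Fin n))) 0 = idemProd K Finset.univ := by
  have hx : xMon (0 : Index (∅ : Finset (Fin n))) = 1 := by ext j <;> simp [xMon]
  have hy : yMon (0 : Index (∅ : Finset (Fin n))) = 1 := by ext j <;> simp [yMon]
  rw [matrixUnit, hx, hy, ← MonoidAlgebra.one_def, one_mul, mul_one, Finset.compl_empty]

variable {K} in
-- Multiplying a nonzero `a` by matrix units on both sides isolates one nonzero entry, an invertible
-- scalar, times the matrix unit at `(0, 0)`.
lemma idemProd_univ_mem {I : TwoSidedIdeal (MonomialAlg K n)} (hI : I ≠ ⊥) :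
    idemProd K Finset.univ ∈ I := by
  obtain ⟨a, haI, ha⟩ := Set.not_subset.mp fun h => hI (le_bot_iff.mp h)
  rw [← repKer_empty K] at ha
  obtain ⟨m, m', hm⟩ := exists_coeff_ne_zero ha
  obtain ⟨c, hc⟩ := exists_rep_empty_apply K a m m'
  have hc0 : c ≠ 0 := by
    rintro rfl
    exact hm (by rw [hc, map_zero])
  have h : matrixUnit K 0 m' * a * matrixUnit K m 0 =
      c • matrixUnit K (0 : Index (∅ : Finset (Fin n))) 0 := by
    refine rep_injective K (Finsupp.lhom_ext fun l r => ?_)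
    rw [map_mul, map_mul, Module.End.mul_apply, Module.End.mul_apply, map_smul,
      LinearMap.smul_apply, rep_matrixUnit, rep_matrixUnit, rep_matrixUnit]
    simp only [LinearMap.comp_apply, Finsupp.lapply_apply, Finsupp.lsingle_apply]
    rw [← mul_one (Finsupp.single l r 0), ← smul_eq_mul, ← Finsupp.smul_single, map_smul,
      Finsupp.smul_apply, hc, smul_eq_mul, mul_comm, ← Algebra.smul_def, Finsupp.smul_single,
      smul_eq_mul, mul_one]
  rw [← matrixUnit_zero, ← one_smul K (matrixUnit K 0 0), ← inv_mul_cancel₀ hc0, mul_smul, ← h,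
    Algebra.smul_def]
  exact I.mul_mem_left _ _ (I.mul_mem_right _ _ (I.mul_mem_left _ _ haI))

variable {K} in
lemma exists_repKer_le {P : TwoSidedIdeal (MonomialAlg K n)} (hP : P.IsPrimeIdeal) (h : P ≠ ⊥) :
    ∃ j, repKer K {j} ≤ P := by
  obtain ⟨j, -, hj⟩ := exists_idem_mem hP _ (idemProd_univ_mem h)
  exact ⟨j, repKer_le_iff.mpr (by simpa using hj)⟩

/-- The kernel of the representation as an element of the poset of prime ideals. -/
noncomputable def repPrime : {P : TwoSidedIdeal (MonomialAlg K n) // P.IsPrimeIdeal} :=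
  ⟨repKer K T, isPrimeIdeal_repKer K T⟩

lemma height_repPrime_empty : Order.height (repPrime K (∅ : Finset (Fin n))) = 0 :=
  Order.height_eq_zero.mpr fun Q _ => by
    change repKer K ∅ ≤ Q.1
    rw [repKer_empty]
    exact bot_le

lemma repPrime_empty_lt (i : Fin n) : repPrime K ∅ < repPrime K {i} := by
  refine lt_of_le_not_ge ((repKer_le_repKer K).mpr (Finset.empty_subset _)) fun h => ?_
  simpa using (repKer_le_repKer K).mp h

/-- A nonzero prime strictly below `repKer K {i}` would contain some `repKer K {j}`, forcing `j =
i`; so only the zero ideal lies strictly below. -/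
lemma height_repPrime_singleton (i : Fin n) : Order.height (repPrime K {i}) = 1 := by
  refine le_antisymm (Order.height_le_coe_iff.mpr fun Q hQ => ?_) ?_
  · have hQ0 : (Q : TwoSidedIdeal (MonomialAlg K n)) = ⊥ := by
      by_contra h
      obtain ⟨j, hj⟩ := exists_repKer_le Q.2 h
      have hji := (repKer_le_repKer K).mp (hj.trans hQ.le)
      rw [Finset.singleton_subset_singleton] at hji
      subst hji
      exact hQ.not_ge hj
    have : Q = repPrime K ∅ := Subtype.ext (hQ0.trans (repKer_empty K).symm)
    rw [this, height_repPrime_empty]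
    exact zero_lt_one
  · rw [Order.one_le_iff_ne_zero, Ne, Order.height_eq_zero]
    exact fun h => h.not_lt (repPrime_empty_lt K i)

variable {K} in
lemma height_eq_one_iff (P : {P : TwoSidedIdeal (MonomialAlg K n) // P.IsPrimeIdeal}) :
    Order.height P = 1 ↔ ∃ i, P = repPrime K {i} := by
  refine ⟨fun h => ?_, fun ⟨i, hi⟩ => hi ▸ height_repPrime_singleton K i⟩
  have hP : (P : TwoSidedIdeal (MonomialAlg K n)) ≠ ⊥ := by
    intro h0
    have : P = repPrime K ∅ := Subtype.ext (h0.trans (repKer_empty K).symm)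
    rw [this, height_repPrime_empty] at h
    exact zero_ne_one h
  obtain ⟨i, hi⟩ := exists_repKer_le P.2 hP
  refine ⟨i, ?_⟩
  by_contra hne
  -- A prime strictly above one of height `1` has height greater than `1`.
  have hlt : repPrime K {i} < P := lt_of_le_of_ne hi (Ne.symm hne)
  have := (Order.height_le_coe_iff (n := 1)).mp h.le _ hlt
  rw [height_repPrime_singleton] at this
  exact lt_irrefl _ this

lemma sumHeightOnePrimes_eq : sumHeightOnePrimes (MonomialAlg K n) = repKer K Finset.univ := by
  refine le_antisymm (iSup_le fun P => iSup_le fun hP => ?_) (repKer_le_iff.mpr fun j _ => ?_)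
  · obtain ⟨i, rfl⟩ := (height_eq_one_iff P).mp hP
    exact (repKer_le_repKer K).mpr (Finset.subset_univ _)
  · have h : repKer K {j} ≤ sumHeightOnePrimes (MonomialAlg K n) :=
      le_iSup_of_le (repPrime K {j}) (le_iSup_of_le (height_repPrime_singleton K j) le_rfl)
    exact h ((idem_mem_repKer K _).mpr (Finset.mem_singleton_self j))

end MonomialAlg

end Primes

/-! ### Invertible elements under two unique products. -/

/-- If the supports had more than one pair, two distinct pairs would have unique products. Each
contributes a nonzero coefficient to `f * g = 1`, so both products equal `1`, against uniqueness. -/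
lemma MonoidAlgebra.exists_eq_single_of_mul_eq_one {K G : Type*} [Field K] [Monoid G]
    [TwoUniqueProds G] {f g : MonoidAlgebra K G} (h : f * g = 1) :
    ∃ d, ∃ c ≠ 0, f = MonoidAlgebra.single d c := by
  have hf : f ≠ 0 := by rintro rfl; simp at h
  have hg : g ≠ 0 := by rintro rfl; simp at h
  have hf' : 0 < f.coeff.support.card := by
    rwa [Finset.card_pos, Finsupp.support_nonempty_iff, Ne, MonoidAlgebra.coeff_eq_zero]
  have hg' : 0 < g.coeff.support.card := by
    rwa [Finset.card_pos, Finsupp.support_nonempty_iff, Ne, MonoidAlgebra.coeff_eq_zero]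
  have hcard : f.coeff.support.card * g.coeff.support.card ≤ 1 := by
    by_contra! hc
    obtain ⟨p, hp, q, hq, hpq, hup, huq⟩ := TwoUniqueProds.uniqueMul_of_one_lt_card hc
    have key : ∀ r ∈ f.coeff.support ×ˢ g.coeff.support,
        UniqueMul f.coeff.support g.coeff.support r.1 r.2 → r.1 * r.2 = 1 := by
      intro r hr hur
      rw [Finset.mem_product, Finsupp.mem_support_iff, Finsupp.mem_support_iff] at hr
      have h1 := MonoidAlgebra.coeff_mul_mul_of_uniqueMul hur
      by_contra hne
      rw [h, MonoidAlgebra.one_def, MonoidAlgebra.coeff_single,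
        Finsupp.single_eq_of_ne hne] at h1
      exact mul_ne_zero hr.1 hr.2 h1.symm
    have h2 := hup (Finset.mem_product.mp hq).1 (Finset.mem_product.mp hq).2
      ((key q hq huq).trans (key p hp hup).symm)
    exact hpq (Prod.ext h2.1.symm h2.2.symm)
  have h1 : f.coeff.support.card = 1 := by nlinarith
  obtain ⟨d, c, hc, hfc⟩ := Finsupp.card_support_eq_one'.mp h1
  exact ⟨d, c, hc, MonoidAlgebra.coeff_injective hfc⟩

/-! ### A rank obstruction to invertible shifts. -/

section Shift

variable {R : Type*} [CommRing R]

lemma Finsupp.map_mem_supported {ι κ : Type*} (U : (ι →₀ R) →ₗ[R] (κ →₀ R)) {s : Set ι} {t : Set κ}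
    (h : ∀ m ∈ s, U (Finsupp.single m 1) ∈ Finsupp.supported R R t) {x : ι →₀ R}
    (hx : x ∈ Finsupp.supported R R s) : U x ∈ Finsupp.supported R R t := by
  rw [Finsupp.supported_eq_span_single] at hx
  have : Submodule.span R ((fun i => Finsupp.single i (1 : R)) '' s) ≤
      (Finsupp.supported R R t).comap U := by
    rw [Submodule.span_le]
    rintro _ ⟨m, hm, rfl⟩
    exact h m hm
  exact this hx

/-- An invertible endomorphism of `R[ℕ]` that eventually agrees, up to a factor, with the shift
by `k`, has `k = 0`. -/
lemma eq_zero_of_eventually_shift [Nontrivial R] {U V : Module.End R (ℕ →₀ R)} (hUV : U * V = 1)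
    (hVU : V * U = 1) {k N₀ : ℕ} {c : R}
    (h : ∀ m, N₀ ≤ m → U (Finsupp.single m 1) = Finsupp.single (m + k) c) : k = 0 := by
  obtain ⟨D, hD⟩ : ∃ D, ∀ m < N₀, ∀ l, D ≤ l → U (Finsupp.single m 1) l = 0 := by
    let F : Finset ℕ := (Finset.range N₀).biUnion fun m => (U (Finsupp.single m 1)).support
    refine ⟨F.sup id + 1, fun m hm l hl => ?_⟩
    by_contra hne
    have : l ≤ F.sup id := Finset.le_sup (f := id) (Finset.mem_biUnion.mpr
      ⟨m, Finset.mem_range.mpr hm, Finsupp.mem_support_iff.mpr hne⟩)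
    omega
  -- With this cut-off `U` maps the span of the exponents below `N` into that below `N + k`, and the
  -- span from `N` on into that from `N + k` on.
  let N := max N₀ D
  have hlow : ∀ x ∈ Finsupp.supported R R (Set.Iio N),
      U x ∈ Finsupp.supported R R (Set.Iio (N + k)) := fun x hx => by
    refine Finsupp.map_mem_supported U (fun m hm => ?_) hx
    by_cases hm0 : m < N₀
    · refine (Finsupp.mem_supported' R _).mpr fun l hl => hD m hm0 l ?_
      have := le_max_right N₀ D
      simp only [Set.mem_Iio, not_lt] at hl
      omega
    · rw [h m (not_lt.mp hm0)]
      exact Finsupp.single_mem_supported R _ (by simpa using hm)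
  have hhigh : ∀ x ∈ Finsupp.supported R R (Set.Ici N),
      U x ∈ Finsupp.supported R R (Set.Ici (N + k)) := fun x hx => by
    refine Finsupp.map_mem_supported U (fun m hm => ?_) hx
    rw [h m ((le_max_left _ _).trans hm)]
    exact Finsupp.single_mem_supported R _ (by simpa using hm)
  -- The high part `b` of `V x` has image supported both below `N + k` and from `N + k` on, so `b =
  -- 0`. Thus `V` embeds rank `N + k` into rank `N`.
  have hV : ∀ x ∈ Finsupp.supported R R (Set.Iio (N + k)),
      V x ∈ Finsupp.supported R R (Set.Iio N) := fun x hx => by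
    let a := (V x).filter (· < N)
    let b := (V x).filter fun m => ¬ m < N
    have hab : a + b = V x := Finsupp.filter_add_filter_not _ _
    have ha : a ∈ Finsupp.supported R R (Set.Iio N) := (Finsupp.mem_supported' R _).mpr
      fun m hm => Finsupp.filter_apply_neg _ _ hm
    have hb : b ∈ Finsupp.supported R R (Set.Ici N) := (Finsupp.mem_supported' R _).mpr
      fun m hm => Finsupp.filter_apply_neg _ _ (by simpa using hm)
    have hUx : U a + U b = x := by
      rw [← map_add, hab, ← Module.End.mul_apply, hUV, Module.End.one_apply]
    have hUb : U b ∈ Finsupp.supported R R (Set.Iio (N + k)) := by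
      rw [eq_sub_iff_add_eq'.mpr hUx]
      exact Submodule.sub_mem _ hx (hlow a ha)
    have hUb0 : U b = 0 := by
      ext l
      by_cases hl : l < N + k
      · exact (Finsupp.mem_supported' R _).mp (hhigh b hb) l (by simpa using hl)
      · exact (Finsupp.mem_supported' R _).mp hUb l (by simpa using hl)
    have hb0 : b = 0 := by
      rw [← Module.End.one_apply (R := R) b, ← hVU, Module.End.mul_apply, hUb0, map_zero]
    rw [← hab, hb0, add_zero]
    exact ha
  have hinj : Function.Injective (V.restrict hV) := fun x y hxy => by
    have h1 : V x = V y := congrArg Subtype.val hxy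
    have h2 := congrArg U h1
    rw [← Module.End.mul_apply, ← Module.End.mul_apply, hUV] at h2
    exact Subtype.ext h2
  have e : ∀ p : ℕ, Finsupp.supported R R (Set.Iio p) ≃ₗ[R] (Fin p →₀ R) := fun p =>
    (Finsupp.supportedEquivFinsupp (Set.Iio p)).trans
      (Finsupp.domLCongr (Fin.equivSubtype.symm : Set.Iio p ≃ Fin p))
  have : Module.Finite R (Finsupp.supported R R (Set.Iio N)) := Module.Finite.equiv (e N).symm
  have hle := LinearMap.finrank_le_finrank_of_injective hinj
  rw [(e N).finrank_eq, (e (N + k)).finrank_eq, Module.finrank_finsupp_self,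
    Module.finrank_finsupp_self, Fintype.card_fin, Fintype.card_fin] at hle
  omega

end Shift

/-! ### Units modulo `𝔞ₙ`, and commutation with matrix units. -/

section Units

variable (K : Type*) [Field K] {n : ℕ}

namespace MonomialAlg

/-- The homomorphism onto the Laurent polynomial algebra. -/
noncomputable def toLaurent : MonomialAlg K n →ₐ[K] LaurentAlg K n :=
  MonoidAlgebra.lift K _ _ ((MonoidAlgebra.of K _).comp (degHom Finset.univ))

lemma toLaurent_single (b : Fin n → Bicyclic) (c : K) :
    toLaurent K (MonoidAlgebra.single b c) = MonoidAlgebra.single (degHom Finset.univ b) c := by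
  simp [toLaurent]

variable {K} in
-- No variable lies outside `univ`, so there is a single exponent and `a` acts as multiplication by
-- `toLaurent K a`.
lemma mem_repKer_univ {a : MonomialAlg K n} (h : toLaurent K a = 0) :
    a ∈ repKer K Finset.univ := by
  rw [mem_repKer]
  refine Finsupp.lhom_ext fun m r => ?_
  have hi : ∀ j : {j // j ∉ (Finset.univ : Finset (Fin n))}, False :=
    fun j => j.2 (Finset.mem_univ _)
  have hsum : toLaurent K a =
      ∑ b ∈ a.coeff.support, MonoidAlgebra.single (degHom Finset.univ b) (a.coeff b) := by
    conv_lhs => rw [eq_sum_single a]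
    simp only [map_sum, toLaurent_single]
  have hs : ∀ b : Fin n → Bicyclic, shift b m = m := fun b => funext fun j => (hi j).elim
  rw [rep_apply_single, LinearMap.zero_apply]
  simp only [hs, fun b : Fin n → Bicyclic => iff_true_intro
    (fun j : {j // j ∉ (Finset.univ : Finset (Fin n))} => (hi j).elim :
      ∀ j : {j // j ∉ (Finset.univ : Finset (Fin n))}, (b j).y ≤ m j), if_true]
  rw [← Finsupp.single_finsetSum, ← Finset.mul_sum, ← hsum, h, mul_zero, Finsupp.single_zero]

variable {K} in
-- The elements with this property form a two-sided ideal, so it suffices to test the generators: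
-- `idem K j` acts as zero for `j ≠ i`, and `idem K i` kills every positive exponent.
lemma eventually_rep_eq_zero (i : Fin n) {f : MonomialAlg K n} (hf : f ∈ repKer K Finset.univ)
    (ι : {j // j ∉ ({i}ᶜ : Finset (Fin n))}) :
    ∃ N, ∀ m : Index ({i}ᶜ : Finset (Fin n)), N ≤ m ι →
      ∀ r, rep K {i}ᶜ f (Finsupp.single m r) = 0 := by
  let J : TwoSidedIdeal (MonomialAlg K n) := .mk'
    {f | ∃ N, ∀ m : Index ({i}ᶜ : Finset (Fin n)), N ≤ m ι →
      ∀ r, rep K {i}ᶜ f (Finsupp.single m r) = 0}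
    ⟨0, fun m _ r => by simp⟩
    (fun {x y} ⟨N, hx⟩ ⟨N', hy⟩ => ⟨max N N', fun m hm r => by
      rw [map_add, LinearMap.add_apply, hx m (le_of_max_le_left hm),
        hy m (le_of_max_le_right hm), add_zero]⟩)
    (fun {x} ⟨N, hx⟩ => ⟨N, fun m hm r => by
      rw [map_neg, LinearMap.neg_apply, hx m hm, neg_zero]⟩)
    (fun {x y} ⟨N, hy⟩ => ⟨N, fun m hm r => by
      rw [map_mul, Module.End.mul_apply, hy m hm, map_zero]⟩)
    -- Acting first by `y` lowers the exponent by at most this sum.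
    (fun {x y} ⟨N, hx⟩ => ⟨N + ∑ b ∈ y.coeff.support, (b ι).y, fun m hm r => by
      rw [map_mul, Module.End.mul_apply, rep_apply_single, map_sum]
      refine Finset.sum_eq_zero fun b hb => ?_
      have hle : (b ι).y ≤ ∑ b ∈ y.coeff.support, (b ι).y :=
        Finset.single_le_sum (f := fun b : Fin n → Bicyclic => (b ι).y)
          (fun _ _ => Nat.zero_le _) hb
      split_ifs
      · refine hx _ ?_ _
        simp only [shift]
        omega
      · exact map_zero _⟩)
  have hJ : repKer K Finset.univ ≤ J := repKer_le_iff.mpr fun j _ => by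
    rw [TwoSidedIdeal.mem_mk']
    by_cases hj : j ∈ ({i}ᶜ : Finset (Fin n))
    · exact ⟨0, fun m _ r => by rw [rep_idem_of_mem K _ hj, LinearMap.zero_apply]⟩
    · refine ⟨1, fun m hm r => ?_⟩
      rw [rep_idem_of_notMem K _ hj, if_neg]
      have h1 := ι.2
      have : ι = ⟨j, hj⟩ := Subtype.ext (by
        simp only [Finset.mem_compl, Finset.mem_singleton, not_not] at h1 hj
        exact h1.trans hj.symm)
      rw [← this]
      omega
  have h := hJ hf
  rwa [TwoSidedIdeal.mem_mk'] at h

variable {K} in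
lemma exponent_nonpos {u v : MonomialAlg K n} (huv : u * v = 1) (hvu : v * u = 1)
    {α : Fin n → ℤ} {c : K}
    (h : toLaurent K u = MonoidAlgebra.single (Multiplicative.ofAdd α) c) (i : Fin n) :
    α i ≤ 0 := by
  by_contra! hα
  -- A monomial of degree `α`; it contains no `y i` because `α i > 0`, so it shifts the exponent of
  -- `x i` up by `α i`.
  let w : Fin n → Bicyclic := fun j => ⟨(α j).toNat, (-α j).toNat⟩
  have hw : degHom Finset.univ w = Multiplicative.ofAdd α := by
    refine congrArg Multiplicative.ofAdd ?_
    ext j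
    simp [w]
  let ι : {j // j ∉ ({i}ᶜ : Finset (Fin n))} := ⟨i, by simp⟩
  have hι : ∀ j : {j // j ∉ ({i}ᶜ : Finset (Fin n))}, j = ι := fun j => Subtype.ext (by
    have := j.2
    simpa [ι] using this)
  obtain ⟨N, hN⟩ := eventually_rep_eq_zero i (f := u - MonoidAlgebra.single w c)
    (mem_repKer_univ (by rw [map_sub, toLaurent_single, hw, h, sub_self])) ι
  let e : Index ({i}ᶜ : Finset (Fin n)) ≃ ℕ :=
    { toFun := fun m => m ι
      invFun := fun k _ => k
      left_inv := fun m => funext fun j => by rw [hι j]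
      right_inv := fun k => rfl }
  let E := Finsupp.domLCongr (M := LaurentAlg K n) (R := LaurentAlg K n) e
  have hwy : (w i).y = 0 := by
    simp only [w]
    omega
  have hk := eq_zero_of_eventually_shift (U := E.conj (rep K {i}ᶜ u)) (V := E.conj (rep K {i}ᶜ v))
    (k := (α i).toNat) (N₀ := N) (c := MonoidAlgebra.single (degHom {i}ᶜ w) c)
    (by rw [Module.End.mul_eq_comp, ← LinearEquiv.conj_comp, ← Module.End.mul_eq_comp, ← map_mul,
          huv, map_one, Module.End.one_eq_id, LinearEquiv.conj_id, Module.End.one_eq_id])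
    (by rw [Module.End.mul_eq_comp, ← LinearEquiv.conj_comp, ← Module.End.mul_eq_comp, ← map_mul,
          hvu, map_one, Module.End.one_eq_id, LinearEquiv.conj_id, Module.End.one_eq_id])
    (fun m hm => by
      have h1 := hN (e.symm m) hm 1
      rw [map_sub, LinearMap.sub_apply, sub_eq_zero, rep_single, if_pos, one_mul] at h1
      · rw [LinearEquiv.conj_apply_apply, Finsupp.domLCongr_symm, Finsupp.domLCongr_single, h1,
          Finsupp.domLCongr_single]
        congr 1
        change m - (w i).y + (w i).x = _
        rw [hwy]
        rfl
      · intro j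
        rw [hι j]
        change (w i).y ≤ _
        omega)
  omega

variable {K} in
/-- A unit is a nonzero scalar modulo the sum of the prime ideals of height one. -/
lemma exists_sub_algebraMap_mem {u v : MonomialAlg K n} (huv : u * v = 1) (hvu : v * u = 1) :
    ∃ c ≠ 0, u - algebraMap K _ c ∈ repKer K (Finset.univ : Finset (Fin n)) := by
  have h1 : toLaurent K u * toLaurent K v = 1 := by rw [← map_mul, huv, map_one]
  have h2 : toLaurent K v * toLaurent K u = 1 := by rw [← map_mul, hvu, map_one]
  obtain ⟨d, c, hc, hu⟩ := MonoidAlgebra.exists_eq_single_of_mul_eq_one h1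
  obtain ⟨d', c', hc', hv⟩ := MonoidAlgebra.exists_eq_single_of_mul_eq_one h2
  rw [hu, hv, MonoidAlgebra.single_mul_single, MonoidAlgebra.one_def, MonoidAlgebra.single_inj] at h1
  have hd : d * d' = 1 := by
    rcases h1 with h1 | h1
    · exact h1.1
    · exact absurd h1.2 one_ne_zero
  -- The degrees of `u` and its inverse are both nonpositive and sum to zero.
  have hd1 : d = 1 := by
    refine Multiplicative.toAdd.injective (funext fun i => ?_)
    have h3 := exponent_nonpos huv hvu (α := Multiplicative.toAdd d) hu i
    have h4 := exponent_nonpos hvu huv (α := Multiplicative.toAdd d') hv i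
    have h5 : Multiplicative.toAdd d i + Multiplicative.toAdd d' i = 0 :=
      congrFun (congrArg Multiplicative.toAdd hd) i
    change Multiplicative.toAdd d i = 0
    omega
  refine ⟨c, hc, mem_repKer_univ ?_⟩
  rw [map_sub, hu, hd1, AlgHom.commutes, sub_eq_zero]
  rfl

variable {K} in
lemma matrixUnit_mem_repKer {m k : Index (∅ : Finset (Fin n))} (hmk : m ≠ k) :
    matrixUnit K m k ∈ repKer K (Finset.univ : Finset (Fin n)) := by
  -- Distinct exponents force `n > 0`, so the product of idempotents has a factor.
  obtain ⟨i, -⟩ := Function.ne_iff.mp hmk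
  refine TwoSidedIdeal.mul_mem_right _ _ _ (TwoSidedIdeal.mul_mem_left _ _ _ ?_)
  exact idemProd_mem K (j := i.1) (by simp)
    ((idem_mem_repKer K _).mpr (Finset.mem_univ _))

variable {K} in
lemma matrixUnit_mul_self {m k : Index (∅ : Finset (Fin n))} (hmk : m ≠ k) :
    matrixUnit K m k * matrixUnit K m k = 0 := by
  refine rep_injective K (Finsupp.lhom_ext fun l r => ?_)
  rw [map_mul, Module.End.mul_apply, rep_matrixUnit]
  simp [hmk.symm]

variable {K} in
/-- An element that commutes with the off-diagonal matrix units is a scalar. -/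
lemma exists_eq_algebraMap {u : MonomialAlg K n}
    (hu : ∀ m k : Index (∅ : Finset (Fin n)), m ≠ k →
      u * matrixUnit K m k = matrixUnit K m k * u) :
    ∃ c, u = algebraMap K _ c := by
  let f : Index (∅ : Finset (Fin n)) → LaurentAlg K n := fun m => rep K ∅ u (Finsupp.single m 1) m
  -- Evaluating the commutation relation at the basis vector `k` compares column `m` of `u` with its
  -- `k`-th diagonal entry.
  have hf : ∀ m k, m ≠ k → rep K ∅ u (Finsupp.single m 1) = Finsupp.single m (f k) := by
    intro m k hmk
    have h1 := LinearMap.congr_fun (congrArg (rep K ∅) (hu m k hmk)) (Finsupp.single k 1)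
    rw [map_mul, map_mul, Module.End.mul_apply, Module.End.mul_apply, rep_matrixUnit] at h1
    simpa using h1
  have hf' : ∀ m, rep K ∅ u (Finsupp.single m 1) = Finsupp.single m (f 0) := by
    intro m
    by_cases hm : m = 0
    · subst hm
      -- Without a second index (`n = 0`) there is only one matrix entry and nothing to compare.
      by_cases hk : ∃ k : Index (∅ : Finset (Fin n)), 0 ≠ k
      · obtain ⟨k, hk⟩ := hk
        rw [hf 0 k hk]
        simp only [f, hf 0 k hk, Finsupp.single_eq_same]
      · push Not at hk
        ext1 l
        rw [← hk l, Finsupp.single_eq_same]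
    · exact hf m 0 hm
  obtain ⟨c, hc⟩ := exists_rep_empty_apply K u 0 0
  refine ⟨c, rep_injective K (Finsupp.lhom_ext' fun m => LinearMap.ext_ring ?_)⟩
  rw [AlgHom.commutes, LinearMap.comp_apply, LinearMap.comp_apply, Finsupp.lsingle_apply, hf',
    Module.algebraMap_end_apply, Finsupp.smul_single, ← Algebra.algebraMap_eq_smul_one]
  exact congrArg _ hc

end MonomialAlg

end Units

/-! ### Transport of height-one primes along ring isomorphisms. -/

section Transfer

variable {R S : Type*} [Ring R] [Ring S]

lemma TwoSidedIdeal.IsPrimeIdeal.comap_equiv (e : R ≃+* S) {P : TwoSidedIdeal S}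
    (hP : P.IsPrimeIdeal) : (P.comap e).IsPrimeIdeal := by
  refine ⟨fun h => hP.1 ?_, fun I J hIJ => ?_⟩
  · rw [← TwoSidedIdeal.one_mem_iff, TwoSidedIdeal.mem_comap, map_one] at h
    exact (TwoSidedIdeal.one_mem_iff P).mp h
  · have key : ∀ L : TwoSidedIdeal R, L.comap e.symm ≤ P → L ≤ P.comap e := fun L hL x hx => by
      rw [TwoSidedIdeal.mem_comap]
      exact hL (TwoSidedIdeal.mem_comap _ |>.mpr (by simpa using hx))
    refine (hP.2 (I.comap e.symm) (J.comap e.symm) fun a ha b hb => ?_).imp (key I) (key J)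
    rw [TwoSidedIdeal.mem_comap] at ha hb
    have := hIJ _ ha _ hb
    rwa [TwoSidedIdeal.mem_comap, map_mul, RingEquiv.apply_symm_apply,
      RingEquiv.apply_symm_apply] at this

/-- The order isomorphism of the posets of prime ideals of isomorphic rings. -/
def RingEquiv.mapPrimeIdeal (e : R ≃+* S) :
    {P : TwoSidedIdeal R // P.IsPrimeIdeal} ≃o {P : TwoSidedIdeal S // P.IsPrimeIdeal} where
  toEquiv := e.mapTwoSidedIdeal.toEquiv.subtypeEquiv fun P => by
    refine ⟨fun h => h.comap_equiv e.symm, fun h => ?_⟩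
    have h1 := TwoSidedIdeal.IsPrimeIdeal.comap_equiv e h
    have h2 : (e.mapTwoSidedIdeal P).comap e = P := e.mapTwoSidedIdeal.symm_apply_apply P
    exact h2 ▸ h1
  map_rel_iff' := e.mapTwoSidedIdeal.map_rel_iff

lemma map_mem_sumHeightOnePrimes (e : R ≃+* S) {x : R} (hx : x ∈ sumHeightOnePrimes R) :
    e x ∈ sumHeightOnePrimes S := by
  have hle : sumHeightOnePrimes R ≤ (sumHeightOnePrimes S).comap e := by
    refine iSup_le fun P => iSup_le fun hP y hy => ?_
    rw [TwoSidedIdeal.mem_comap]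
    have h : ((e.mapPrimeIdeal P : {P : TwoSidedIdeal S // P.IsPrimeIdeal}) : TwoSidedIdeal S) ≤
        sumHeightOnePrimes S :=
      le_iSup_of_le (e.mapPrimeIdeal P)
        (le_iSup_of_le ((Order.height_orderIso e.mapPrimeIdeal P).trans hP) le_rfl)
    exact h ((TwoSidedIdeal.mem_comap e.symm).mpr (by simpa using hy))
  exact (TwoSidedIdeal.mem_comap e).mp (hle hx)

lemma map_mem_sumHeightOnePrimes_iff (e : R ≃+* S) {x : R} :
    e x ∈ sumHeightOnePrimes S ↔ x ∈ sumHeightOnePrimes R :=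
  ⟨fun h => by simpa using map_mem_sumHeightOnePrimes e.symm h, map_mem_sumHeightOnePrimes e⟩

end Transfer

/-! ### Formal consequences for the unit group. -/

section UnitGroup

variable {K S : Type*} [Field K] [Ring S] [Algebra K S] {I : TwoSidedIdeal S}

lemma TwoSidedIdeal.mem_oneAdd {x : S} : x ∈ I.oneAdd ↔ x - 1 ∈ I :=
  ⟨fun ⟨a, ha, hx⟩ => by rw [hx]; simpa using ha, fun h => ⟨x - 1, h, by abel⟩⟩

/-- The inverse needs no separate condition, since `u⁻¹ - 1 = -u⁻¹ * (u - 1)`. -/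
lemma TwoSidedIdeal.mem_oneAdd_units {u : Sˣ} : u ∈ I.oneAdd.units ↔ (u : S) - 1 ∈ I := by
  rw [Submonoid.mem_units_iff, mem_oneAdd, mem_oneAdd, and_iff_left_iff_imp]
  intro h
  have : ((u⁻¹ : Sˣ) : S) - 1 = -((u⁻¹ : Sˣ) : S) * (u - 1) := by
    rw [mul_sub, neg_mul, Units.inv_mul]
    simp
    abel
  rw [this]
  exact I.mul_mem_left _ _ h

lemma eq_one_of_algebraMap_sub_one_mem (hI : I ≠ ⊤) {c : K} (hc : algebraMap K S c - 1 ∈ I) :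
    c = 1 := by
  by_contra h
  refine hI ((TwoSidedIdeal.one_mem_iff I).mp ?_)
  rw [← map_one (algebraMap K S), ← inv_mul_cancel₀ (sub_ne_zero.mpr h), map_mul, map_sub, map_one]
  exact I.mul_mem_left _ _ hc

/-- The homomorphism `(k, u) ↦ k * u` from `K^* × (1 + I)^*` to the group of units. -/
def scalarMulUnit (K : Type*) [Field K] [Algebra K S] (I : TwoSidedIdeal S) :
    Kˣ × I.oneAdd.units →* Sˣ where
  toFun p := Units.map (algebraMap K S).toMonoidHom p.1 * (p.2 : Sˣ)
  map_one' := by simp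
  map_mul' p q := by
    ext
    simp only [Prod.fst_mul, Prod.snd_mul, map_mul, Subgroup.coe_mul, Units.val_mul]
    have : ((Units.map (algebraMap K S).toMonoidHom q.1 : Sˣ) : S) * ((p.2 : Sˣ) : S) =
      ((p.2 : Sˣ) : S) * ((Units.map (algebraMap K S).toMonoidHom q.1 : Sˣ) : S) :=
        Algebra.commutes _ _
    rw [mul_assoc, mul_assoc, ← mul_assoc _ ((p.2 : Sˣ) : S), this, mul_assoc]

lemma scalarMulUnit_bijective (hI : I ≠ ⊤)
    (hunits : ∀ u : Sˣ, ∃ c : K, c ≠ 0 ∧ (u : S) - algebraMap K S c ∈ I) :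
    Function.Bijective (scalarMulUnit K I) := by
  refine ⟨(injective_iff_map_eq_one _).mpr fun p hp => ?_, fun u => ?_⟩
  · obtain ⟨k, u⟩ := p
    have h1 : (Units.map (algebraMap K S).toMonoidHom k : Sˣ) = (u : Sˣ)⁻¹ :=
      eq_inv_of_mul_eq_one_left hp
    have h2 := TwoSidedIdeal.mem_oneAdd_units.mp (inv_mem u.2)
    rw [← h1] at h2
    have hk : k = 1 := Units.ext (eq_one_of_algebraMap_sub_one_mem hI h2)
    subst hk
    rw [map_one] at h1
    exact Prod.ext rfl (Subtype.ext (inv_eq_one.mp h1.symm))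
  · obtain ⟨c, hc, hu⟩ := hunits u
    let k : Sˣ := Units.map (algebraMap K S).toMonoidHom (Units.mk0 c hc)
    have hk : (k : S) = algebraMap K S c := rfl
    have hmem : k⁻¹ * u ∈ I.oneAdd.units := by
      rw [TwoSidedIdeal.mem_oneAdd_units, Units.val_mul, ← Units.inv_mul k, ← mul_sub, hk]
      exact I.mul_mem_left _ _ hu
    exact ⟨(Units.mk0 c hc, ⟨k⁻¹ * u, hmem⟩), mul_inv_cancel_left k u⟩

lemma mem_range_scalars_of_eq [Nontrivial S] {u : Sˣ} {c : K} (h : (u : S) = algebraMap K S c) :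
    u ∈ (Units.map (algebraMap K S).toMonoidHom).range := by
  have hc : c ≠ 0 := by
    rintro rfl
    exact u.ne_zero (by rw [h, map_zero])
  exact ⟨Units.mk0 c hc, Units.ext h.symm⟩

/-- `hcenter` tests commutation only against `(1 + I)^*`, so that the same hypothesis also yields
the centre of `(1 + I)^*` and the injectivity of `u ↦ ω_u`. -/
lemma center_units [Nontrivial S]
    (hcenter : ∀ u : Sˣ, (∀ v ∈ I.oneAdd.units, u * v = v * u) → ∃ c : K, (u : S) = algebraMap K S c) :
    Subgroup.center Sˣ = (Units.map (algebraMap K S).toMonoidHom).range := by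
  refine le_antisymm (fun u hu => ?_) ?_
  · obtain ⟨c, hc⟩ := hcenter u fun v _ => (Subgroup.mem_center_iff.mp hu v).symm
    exact mem_range_scalars_of_eq hc
  · rintro _ ⟨k, rfl⟩
    exact Subgroup.mem_center_iff.mpr fun v => Units.ext (Algebra.commutes _ _).symm

lemma eq_one_of_commute (hI : I ≠ ⊤)
    (hcenter : ∀ u : Sˣ, (∀ v ∈ I.oneAdd.units, u * v = v * u) → ∃ c : K, (u : S) = algebraMap K S c)
    {u : Sˣ} (hu : u ∈ I.oneAdd.units) (h : ∀ v ∈ I.oneAdd.units, u * v = v * u) : u = 1 := by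
  obtain ⟨c, hc⟩ := hcenter u h
  have h1 := TwoSidedIdeal.mem_oneAdd_units.mp hu
  rw [hc] at h1
  exact Units.ext (by rw [hc, eq_one_of_algebraMap_sub_one_mem hI h1, map_one, Units.val_one])

lemma center_oneAdd_units (hI : I ≠ ⊤)
    (hcenter : ∀ u : Sˣ, (∀ v ∈ I.oneAdd.units, u * v = v * u) → ∃ c : K, (u : S) = algebraMap K S c) :
    Subgroup.center I.oneAdd.units = ⊥ := by
  refine le_bot_iff.mp fun u hu => Subgroup.mem_bot.mpr (Subtype.ext ?_)
  exact eq_one_of_commute hI hcenter u.2 fun v hv =>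
    congrArg Subtype.val (Subgroup.mem_center_iff.mp hu ⟨v, hv⟩).symm

/-- Scalars induce the identity, so the decomposition of units gives surjectivity; a `u` with
trivial `ω_u` commutes with everything and so equals `1`. -/
lemma innerAut_bijective (hI : I ≠ ⊤)
    (hunits : ∀ u : Sˣ, ∃ c : K, c ≠ 0 ∧ (u : S) - algebraMap K S c ∈ I)
    (hcenter : ∀ u : Sˣ, (∀ v ∈ I.oneAdd.units, u * v = v * u) → ∃ c : K, (u : S) = algebraMap K S c) :
    Function.Bijective ((innerAut K S).rangeRestrict.comp I.oneAdd.units.subtype) := by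
  refine ⟨(injective_iff_map_eq_one _).mpr fun u hu => Subtype.ext ?_, fun ⟨_, w, hw⟩ => ?_⟩
  · refine eq_one_of_commute hI hcenter u.2 fun v _ => ?_
    have h1 : innerAut K S u = 1 := congrArg Subtype.val hu
    have h2 : ((u : Sˣ) : S) * v * ((u : Sˣ)⁻¹ : Sˣ) = v := DFunLike.congr_fun h1 (v : S)
    exact mul_inv_eq_iff_eq_mul.mp (Units.ext h2)
  · obtain ⟨⟨k, u⟩, rfl⟩ := (scalarMulUnit_bijective hI hunits).2 w
    refine ⟨u, Subtype.ext ?_⟩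
    have hk : innerAut K S (Units.map (algebraMap K S).toMonoidHom k) = 1 := by
      ext a
      change algebraMap K S k * a * algebraMap K S (k⁻¹ : Kˣ) = a
      rw [Algebra.commutes, mul_assoc, ← map_mul, Units.mul_inv, map_one, mul_one]
    refine Eq.trans ?_ hw
    change innerAut K S u = innerAut K S (Units.map (algebraMap K S).toMonoidHom k * u)
    rw [map_mul, hk, one_mul]

end UnitGroup

/-! ### Application to `𝕊ₙ`. -/

namespace OneSidedInv

variable (K : Type*) [Field K] (n : ℕ)

lemma mem_sumHeightOnePrimes_iff {x : OneSidedInv K n} :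
    x ∈ sumHeightOnePrimes (OneSidedInv K n) ↔
      equivMonomialAlg K n x ∈ MonomialAlg.repKer K (Finset.univ : Finset (Fin n)) := by
  rw [← MonomialAlg.sumHeightOnePrimes_eq]
  exact (map_mem_sumHeightOnePrimes_iff (equivMonomialAlg K n).toRingEquiv).symm

lemma sumHeightOnePrimes_ne_top : sumHeightOnePrimes (OneSidedInv K n) ≠ ⊤ := by
  intro h
  rw [← TwoSidedIdeal.one_mem_iff, mem_sumHeightOnePrimes_iff, map_one] at h
  exact (MonomialAlg.isPrimeIdeal_repKer K _).1 ((TwoSidedIdeal.one_mem_iff _).mp h)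

lemma exists_sub_algebraMap_mem (u : (OneSidedInv K n)ˣ) :
    ∃ c : K, c ≠ 0 ∧ (u : OneSidedInv K n) - algebraMap K _ c ∈
      sumHeightOnePrimes (OneSidedInv K n) := by
  obtain ⟨c, hc, h⟩ := MonomialAlg.exists_sub_algebraMap_mem (u := equivMonomialAlg K n u)
    (v := equivMonomialAlg K n (u⁻¹ : (OneSidedInv K n)ˣ))
    (by rw [← map_mul, Units.mul_inv, map_one]) (by rw [← map_mul, Units.inv_mul, map_one])
  refine ⟨c, hc, (mem_sumHeightOnePrimes_iff K n).mpr ?_⟩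
  rwa [map_sub, AlgEquiv.commutes]

lemma exists_eq_algebraMap (u : (OneSidedInv K n)ˣ)
    (hu : ∀ v ∈ (sumHeightOnePrimes (OneSidedInv K n)).oneAdd.units, u * v = v * u) :
    ∃ c : K, (u : OneSidedInv K n) = algebraMap K _ c := by
  obtain ⟨c, hc⟩ := MonomialAlg.exists_eq_algebraMap (u := equivMonomialAlg K n u)
    fun m k hmk => by
      let E : OneSidedInv K n := (equivMonomialAlg K n).symm (MonomialAlg.matrixUnit K m k)
      have hE : E * E = 0 := by
        rw [← map_mul, MonomialAlg.matrixUnit_mul_self hmk, map_zero]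
      -- Since `E * E = 0`, commuting with the unit `1 + E` amounts to commuting with `E`.
      let v : (OneSidedInv K n)ˣ :=
        ⟨1 + E, 1 - E, by simp [add_mul, mul_sub, hE], by simp [sub_mul, mul_add, hE]⟩
      have hv : v ∈ (sumHeightOnePrimes (OneSidedInv K n)).oneAdd.units := by
        rw [TwoSidedIdeal.mem_oneAdd_units, add_sub_cancel_left, mem_sumHeightOnePrimes_iff,
          AlgEquiv.apply_symm_apply]
        exact MonomialAlg.matrixUnit_mem_repKer hmk
      have h1 : (u : OneSidedInv K n) * (1 + E) = (1 + E) * u := congrArg Units.val (hu v hv)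
      rw [mul_add, add_mul, mul_one, one_mul, add_right_inj] at h1
      simpa [E] using congrArg (equivMonomialAlg K n) h1
  refine ⟨c, (equivMonomialAlg K n).injective ?_⟩
  rw [hc, AlgEquiv.commutes]

instance : Nontrivial (OneSidedInv K n) := (equivMonomialAlg K n).toEquiv.nontrivial

end OneSidedInv

theorem mainTheorem4 (K : Type*) [Field K] (n : ℕ) :
    -- the group of units is the direct product of `K^*` and `(1 + 𝔞ₙ)^*`
    (∃ e : Kˣ × (sumHeightOnePrimes (OneSidedInv K n)).oneAdd.units ≃* (OneSidedInv K n)ˣ,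
      ∀ (k : Kˣ) (u : (sumHeightOnePrimes (OneSidedInv K n)).oneAdd.units),
        (e (k, u) : OneSidedInv K n) =
          algebraMap K (OneSidedInv K n) k * ((u : (OneSidedInv K n)ˣ) : OneSidedInv K n)) ∧
    -- the centres
    Subgroup.center (OneSidedInv K n)ˣ =
      (Units.map (algebraMap K (OneSidedInv K n)).toMonoidHom).range ∧
    Subgroup.center (sumHeightOnePrimes (OneSidedInv K n)).oneAdd.units = ⊥ ∧
    -- `u ↦ ω_u` is an isomorphism from `(1 + 𝔞ₙ)^*` onto the group of inner automorphisms
    (∃ f : (sumHeightOnePrimes (OneSidedInv K n)).oneAdd.units ≃* Inn K (OneSidedInv K n),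
      ∀ u : (sumHeightOnePrimes (OneSidedInv K n)).oneAdd.units,
        (f u : OneSidedInv K n ≃ₐ[K] OneSidedInv K n) = innerAut K (OneSidedInv K n) u) := by
  have hI := OneSidedInv.sumHeightOnePrimes_ne_top K n
  have hunits := OneSidedInv.exists_sub_algebraMap_mem K n
  have hcenter := OneSidedInv.exists_eq_algebraMap K n
  exact ⟨⟨MulEquiv.ofBijective _ (scalarMulUnit_bijective hI hunits), fun k u => rfl⟩,
    center_units hcenter, center_oneAdd_units hI hcenter,
    ⟨MulEquiv.ofBijective _ (innerAut_bijective hI hunits hcenter), fun u => rfl⟩⟩
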